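/- All manifolds, maps, vector bundles and sections are smooth and real, manifolds are finite dimensional, and vector bundles have finite rank. A **Lie algebroid** over a manifold $X$ is a vector bundle $A\to X$ with a Lie bracket on the space $\Gamma(A)$ of global sections and a vector bundle morphism $a:A\to TX$ (the anchor) that induces a Lie algebra morphism $\Gamma(A)\to\Gamma(TX)$ and satisfies $[\xi,f\eta]=f[\xi,\eta]+a(\xi)(f)\,\eta$ for $\xi,\eta\in\Gamma(A)$, $f\in C^\infty(X)$. If $X$ is Hausdorff the bracket is local, so the sheaf $\mathcal A$ of sections of $A$ is a sheaf of Lie algebras and each stalk $\mathcal A_x$ is a Lie algebra. An isomorphism of Lie algebroids over the same base is a vector bundle isomorphism over the identity that commutes with the anchors and preserves the brackets of sections. If $\varphi:Y\to X$ is étale (a local diffeomorphism) and $A$ is a Lie algebroid over $X$, then $\varphi^!A=\{(v,w)\in TY\oplus\varphi^*A \mid \varphi_*v=a(w)\}$ is a Lie algebroid over $Y$ with anchor $(v,w)\mapsto v$ and bracket $$\Big[v\oplus\textstyle\sum_i f_i\otimes\xi_i,\; v'\oplus\sum_j f'_j\otimes\xi'_j\Big]=[v,v']\oplus\Big(\textstyle\sum_{i,j}f_if'_j\otimes[\xi_i,\xi'_j]+\sum_j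 v(f'_j)\otimes\xi'_j-\sum_i v'(f_i)\otimes\xi_i\Big),$$ where sections of $\varphi^*A$ are written, locally, as sums $\sum_i f_i\otimes\xi_i=\sum_i f_i\,\varphi^*\xi_i$ with $f_i\in C^\infty(Y)$ and $\xi_i\in\Gamma(A)$. The vector bundle $\varphi^*A$ is made into a Lie algebroid by means of the isomorphism of vector bundles $\varphi^*A\cong\varphi^!A$, $(y,w)\mapsto((\varphi_*|_y)^{-1}a(w),w)$. **Proposition.** Let $G\rightrightarrows X$ be an étale Lie groupoid (a Lie groupoid whose source $s$ and target $t$ are local diffeomorphisms; $gh$ is defined when $s(g)=t(h)$) with $X$ Hausdorff, let $A$ be a Lie algebroid over $X$, and let $\psi:s^*A\to t^*A$ be an isomorphism of vector bundles over $G$ that satisfies the cocycle condition $\psi_{gh}=\psi_g\circ\psi_h$ for all $g,h\in G$ with $s(g)=t(h)$, where $\psi_g:A_{s(g)}\to A_{t(g)}$ is the restriction of $\psi$ to the fibres over $g$. Let $g\in G$ act on $TX$ by $$g:T_{s(g)}X\to T_{t(g)}X,\qquad v\mapsto (l_W)_*v,\qquad l_W=t\circ(s|_W)^{-1},$$ where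 $W\subset G$ is an open neighbourhood of $g$ on which $s$ and $t$ are diffeomorphisms onto open sets, and let $g$ act on the stalks of $\mathcal A$ by $$g:\mathcal A_{s(g)}\to\mathcal A_{t(g)},\qquad [\xi]_{s(g)}\mapsto[L_W(\xi)]_{t(g)},$$ where $L_W(\xi)$ is the section of $A$ over $t(W)$ with $L_W(\xi)(t(h))=\psi_h(\xi(s(h)))$ for $h\in W$. Then the following are equivalent: 1. $\psi:s^*A\to t^*A$ is an isomorphism of Lie algebroids over $G$, where $s^*A$ and $t^*A$ carry the Lie algebroid structures given by $s^*A\cong s^!A$ and $t^*A\cong t^!A$. 2. The anchor is $G$-equivariant, that is, $a(\psi_g(w))=g\cdot a(w)$ for all $g\in G$ and $w\in A_{s(g)}$; and $\mathcal A$ is a $G$-sheaf of Lie algebras, that is, for every $g\in G$ the map $g:\mathcal A_{s(g)}\to\mathcal A_{t(g)}$ is an isomorphism of Lie algebras. -/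

import Mathlib

open Bundle Topology Filter Function
open scoped Manifold ContDiff Bundle

set_option linter.unusedSectionVars false

noncomputable section

section Basic

variable {E : Type*} [NormedAddCommGroup E] [NormedSpace ℝ E]
  {X : Type*} [TopologicalSpace X] [ChartedSpace E X] [IsManifold 𝓘(ℝ, E) ∞ X]
  {F : Type*} [NormedAddCommGroup F] [NormedSpace ℝ F]
  {A : X → Type*} [TopologicalSpace (TotalSpace F A)] [∀ x, TopologicalSpace (A x)]
  [∀ x, AddCommGroup (A x)] [∀ x, Module ℝ (A x)] [FiberBundle F A] [VectorBundle ℝ F A]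

instance Bundle.Pullback.instAddCommGroupFiber {Y : Type*} (f : Y → X) (y : Y) :
    AddCommGroup ((f *ᵖ A) y) :=
  inferInstanceAs (AddCommGroup (A (f y)))


/-- The `C^∞(X)`-module structure on smooth sections. -/
def smulSection (f : C^∞⟮𝓘(ℝ, E), X; 𝓘(ℝ, ℝ), ℝ⟯) (ξ : Cₛ^∞⟮𝓘(ℝ, E); F, A⟯) :
    Cₛ^∞⟮𝓘(ℝ, E); F, A⟯ :=
  ⟨fun x => f x • ξ x, f.contMDiff.smul_section ξ.contMDiff⟩

/-- The derivative `v(f)` of a smooth function along a tangent vector. -/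
def dirDeriv (f : C^∞⟮𝓘(ℝ, E), X; 𝓘(ℝ, ℝ), ℝ⟯) (x : X) (v : TangentSpace 𝓘(ℝ, E) x) : ℝ :=
  mfderiv 𝓘(ℝ, E) 𝓘(ℝ, ℝ) f x v

variable (E F A) in
/-- A Lie algebroid structure on the vector bundle `A` over `X`: a Lie bracket on the space `Γ(A)` of
smooth sections and a smooth vector bundle morphism `A → TX`, the anchor, which induces a morphism of
Lie algebras `Γ(A) → Γ(TX)` and satisfies the Leibniz rule. -/
structure LieAlgebroid where
  anchor : ∀ x, A x →ₗ[ℝ] TangentSpace 𝓘(ℝ, E) x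
  contMDiff_anchor : ContMDiff (𝓘(ℝ, E).prod 𝓘(ℝ, F)) (𝓘(ℝ, E).prod 𝓘(ℝ, E)) ∞
    (fun p : TotalSpace F A => (⟨p.1, anchor p.1 p.2⟩ : TangentBundle 𝓘(ℝ, E) X))
  /-- The Lie bracket of sections, an `ℝ`-bilinear map. -/
  bracket : Cₛ^∞⟮𝓘(ℝ, E); F, A⟯ →ₗ[ℝ] Cₛ^∞⟮𝓘(ℝ, E); F, A⟯ →ₗ[ℝ] Cₛ^∞⟮𝓘(ℝ, E); F, A⟯
  bracket_self : ∀ ξ, bracket ξ ξ = 0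
  jacobi : ∀ ξ η ζ, bracket ξ (bracket η ζ) = bracket (bracket ξ η) ζ + bracket η (bracket ξ ζ)
  anchor_bracket : ∀ ξ η x, anchor x (bracket ξ η x) =
    VectorField.mlieBracket 𝓘(ℝ, E) (fun z => anchor z (ξ z)) (fun z => anchor z (η z)) x
  leibniz : ∀ ξ (f : C^∞⟮𝓘(ℝ, E), X; 𝓘(ℝ, ℝ), ℝ⟯) η x, bracket ξ (smulSection f η) x =
    dirDeriv f x (anchor x (ξ x)) • η x + f x • bracket ξ η x

theorem exists_smooth_bump [FiniteDimensional ℝ E] [T2Space X]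
    {x : X} {U : Set X} (hU : U ∈ 𝓝 x) :
    ∃ f : C^∞⟮𝓘(ℝ, E), X; 𝓘(ℝ, ℝ), ℝ⟯, (∀ᶠ z in 𝓝 x, f z = 1) ∧ tsupport f ⊆ U := by
  obtain ⟨f, hf, -⟩ := (SmoothBumpFunction.nhds_basis_support (I := 𝓘(ℝ, E)) hU).mem_iff.1
    (Filter.univ_mem (f := 𝓝 x))
  exact ⟨⟨f, f.contMDiff⟩, f.eventuallyEq_one, hf⟩

theorem exists_section_eventuallyEq [FiniteDimensional ℝ E] [T2Space X]
    {x : X} {U : Set X} (hU : IsOpen U) (hx : x ∈ U) {ξ : ∀ z, A z}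
    (hξ : ContMDiffOn 𝓘(ℝ, E) (𝓘(ℝ, E).prod 𝓘(ℝ, F)) ∞ (fun z => TotalSpace.mk' F z (ξ z)) U) :
    ∃ η : Cₛ^∞⟮𝓘(ℝ, E); F, A⟯, ∀ᶠ z in 𝓝 x, η z = ξ z := by
  obtain ⟨f, h1, h2⟩ := exists_smooth_bump (E := E) (hU.mem_nhds hx)
  refine ⟨⟨_, ContMDiffOn.smul_section_of_tsupport f.contMDiff.contMDiffOn hU h2 hξ⟩, ?_⟩
  filter_upwards [h1] with z hz
  simp [hz]

theorem exists_function_eventuallyEq [FiniteDimensional ℝ E] [T2Space X]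
    {x : X} {U : Set X} (hU : IsOpen U) (hx : x ∈ U) {g : X → ℝ}
    (hg : ContMDiffOn 𝓘(ℝ, E) 𝓘(ℝ, ℝ) ∞ g U) :
    ∃ k : C^∞⟮𝓘(ℝ, E), X; 𝓘(ℝ, ℝ), ℝ⟯, ∀ᶠ z in 𝓝 x, k z = g z := by
  obtain ⟨f, h1, h2⟩ := exists_smooth_bump (E := E) (hU.mem_nhds hx)
  refine ⟨⟨fun z => f z * g z, ?_⟩, ?_⟩
  · refine contMDiff_of_tsupport fun z hz => ?_
    have : z ∈ U := h2 (closure_mono (fun w hw => left_ne_zero_of_mul hw) hz)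
    exact f.contMDiff.contMDiffAt.mul (hg.contMDiffAt (hU.mem_nhds this))
  · filter_upwards [h1] with z hz
    simp [hz]

namespace LieAlgebroid

variable (L : LieAlgebroid E F A)

theorem bracket_swap (ξ η) : L.bracket ξ η = - L.bracket η ξ := by
  have h := L.bracket_self (ξ + η)
  simp only [map_add, LinearMap.add_apply, L.bracket_self, zero_add, add_zero] at h
  exact eq_neg_of_add_eq_zero_right h

theorem leibniz_left (f : C^∞⟮𝓘(ℝ, E), X; 𝓘(ℝ, ℝ), ℝ⟯) (ξ η x) :
    L.bracket (smulSection f ξ) η x =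
      f x • L.bracket ξ η x - dirDeriv f x (L.anchor x (η x)) • ξ x := by
  rw [L.bracket_swap, L.bracket_swap ξ η]
  have := L.leibniz η f ξ x
  simp only [ContMDiffSection.coe_neg, Pi.neg_apply, smul_neg] at *
  rw [this]; abel

variable [FiniteDimensional ℝ E] [T2Space X]

theorem bracket_apply_eq_zero {ξ η : Cₛ^∞⟮𝓘(ℝ, E); F, A⟯} {x : X}
    (h : ∀ᶠ z in 𝓝 x, η z = 0) : L.bracket ξ η x = 0 := by
  obtain ⟨f, h1, h2⟩ := exists_smooth_bump (E := E) h
  have h0 : smulSection f η = 0 := by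
    ext z
    change f z • η z = 0
    by_cases hz : z ∈ tsupport f
    · rw [h2 hz, smul_zero]
    · rw [image_eq_zero_of_notMem_tsupport hz, zero_smul]
  have := L.leibniz ξ f η x
  rw [h0, map_zero, h.self_of_nhds, h1.self_of_nhds] at this
  simpa using this.symm

/-- Locality of the bracket. -/
theorem bracket_congr {ξ ξ' η η' : Cₛ^∞⟮𝓘(ℝ, E); F, A⟯} {x : X}
    (h : ∀ᶠ z in 𝓝 x, ξ z = ξ' z) (h' : ∀ᶠ z in 𝓝 x, η z = η' z) :
    ∀ᶠ z in 𝓝 x, L.bracket ξ η z = L.bracket ξ' η' z := by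
  have key : ∀ (ξ η η' : Cₛ^∞⟮𝓘(ℝ, E); F, A⟯) (z : X), (∀ᶠ z in 𝓝 z, η z = η' z) →
      L.bracket ξ η z = L.bracket ξ η' z := by
    intro ξ η η' z hz
    have := L.bracket_apply_eq_zero (ξ := ξ) (η := η - η') (x := z)
      (hz.mono fun w hw => by simp [hw])
    rw [map_sub] at this
    exact sub_eq_zero.1 this
  filter_upwards [h.eventually_nhds, h'.eventually_nhds] with z hz hz'
  rw [key _ _ _ _ hz', L.bracket_swap ξ, L.bracket_swap ξ']
  simp [key η' _ _ _ hz]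

end LieAlgebroid

end Basic

section PB

variable {E : Type*} [NormedAddCommGroup E] [NormedSpace ℝ E]
  {X : Type*} [TopologicalSpace X] [ChartedSpace E X] [IsManifold 𝓘(ℝ, E) ∞ X]
  {F : Type*} [NormedAddCommGroup F] [NormedSpace ℝ F]
  {A : X → Type*} [TopologicalSpace (TotalSpace F A)] [∀ x, TopologicalSpace (A x)]
  [∀ x, AddCommGroup (A x)] [∀ x, Module ℝ (A x)] [FiberBundle F A] [VectorBundle ℝ F A]
  {E' : Type*} [NormedAddCommGroup E'] [NormedSpace ℝ E']
  {Y : Type*} [TopologicalSpace Y] [ChartedSpace E' Y]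
  (φ : C^∞⟮𝓘(ℝ, E'), Y; 𝓘(ℝ, E), X⟯)

theorem contMDiffAt_pullback_iff {E'' : Type*} [NormedAddCommGroup E''] [NormedSpace ℝ E'']
    {H : Type*} [TopologicalSpace H] {I : ModelWithCorners ℝ E'' H}
    {Z : Type*} [TopologicalSpace Z] [ChartedSpace H Z]
    (g : Z → TotalSpace F ((φ : Y → X) *ᵖ A)) (z : Z) :
    ContMDiffAt I (𝓘(ℝ, E').prod 𝓘(ℝ, F)) ∞ g z ↔
      ContMDiffAt I 𝓘(ℝ, E') ∞ (fun w => (g w).proj) z ∧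
      ContMDiffAt I (𝓘(ℝ, E).prod 𝓘(ℝ, F)) ∞ (fun w => Pullback.lift φ (g w)) z := by
  rw [contMDiffAt_totalSpace, contMDiffAt_totalSpace]
  constructor
  · rintro ⟨h1, h2⟩
    exact ⟨h1, ContMDiffAt.comp (g := φ) z φ.contMDiff.contMDiffAt h1, h2⟩
  · rintro ⟨h1, -, h2⟩
    exact ⟨h1, h2⟩

/-- The pulled back section `φ^*ξ` of `φ^*A`. -/
def pullbackSection (ξ : Cₛ^∞⟮𝓘(ℝ, E); F, A⟯) : Cₛ^∞⟮𝓘(ℝ, E'); F, ((φ : Y → X) *ᵖ A)⟯ :=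
  ⟨fun y => ξ (φ y), fun y => (contMDiffAt_pullback_iff φ _ y).2
    ⟨contMDiffAt_id, (ξ.contMDiff.comp φ.contMDiff).contMDiffAt⟩⟩

end PB

section Etale

variable {E : Type*} [NormedAddCommGroup E] [NormedSpace ℝ E]
  {X : Type*} [TopologicalSpace X] [ChartedSpace E X] [IsManifold 𝓘(ℝ, E) ∞ X]
  {F : Type*} [NormedAddCommGroup F] [NormedSpace ℝ F]
  {A : X → Type*} [TopologicalSpace (TotalSpace F A)] [∀ x, TopologicalSpace (A x)]
  [∀ x, AddCommGroup (A x)] [∀ x, Module ℝ (A x)] [FiberBundle F A] [VectorBundle ℝ F A]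
  {E' : Type*} [NormedAddCommGroup E'] [NormedSpace ℝ E']
  {Y : Type*} [TopologicalSpace Y] [ChartedSpace E' Y] [IsManifold 𝓘(ℝ, E') ∞ Y]
  {φ : C^∞⟮𝓘(ℝ, E'), Y; 𝓘(ℝ, E), X⟯}

theorem two_le_infty : (2 : WithTop ℕ∞) ≤ ∞ := 
  WithTop.coe_le_coe.2 (le_top : (2 : ℕ∞) ≤ ⊤)

theorem isManifold_minSmoothness {E : Type*} [NormedAddCommGroup E] [NormedSpace ℝ E]
    {X : Type*} [TopologicalSpace X] [ChartedSpace E X] [IsManifold 𝓘(ℝ, E) ∞ X] :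
    IsManifold 𝓘(ℝ, E) (minSmoothness ℝ 2) X :=
  IsManifold.of_le (n := ∞) (by simpa using two_le_infty)

theorem exists_section_of_pullback [FiniteDimensional ℝ E] [T2Space X]
    (hφ : IsLocalDiffeomorph 𝓘(ℝ, E') 𝓘(ℝ, E) ∞ φ) {y : Y} {V : Set Y} (hV : IsOpen V)
    (hy : y ∈ V) {σ : ∀ z, ((φ : Y → X) *ᵖ A) z}
    (hσ : ContMDiffOn 𝓘(ℝ, E') (𝓘(ℝ, E').prod 𝓘(ℝ, F)) ∞ (fun z => TotalSpace.mk' F z (σ z)) V) :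
    ∃ ξ : Cₛ^∞⟮𝓘(ℝ, E); F, A⟯, ∀ᶠ z in 𝓝 y, σ z = ξ (φ z) := by
  classical
  set θ := (hφ y).localInverse with hθ
  have hright : ∀ x ∈ θ.source, φ (θ x) = x := fun x hx => (hφ y).localInverse_right_inv hx
  have hleft : ∀ z ∈ θ.target, θ (φ z) = z := fun z hz => (hφ y).localInverse_left_inv hz
  let ξ₀ : ∀ x, A x := fun x => if h : φ (θ x) = x then h ▸ (σ (θ x) : A (φ (θ x))) else 0
  have hξ₀ : ∀ x, φ (θ x) = x →
      TotalSpace.mk' F x (ξ₀ x) = Pullback.lift φ (TotalSpace.mk' F (θ x) (σ (θ x))) := by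
    intro x hx
    have : ∀ (x' : X) (h : x' = x) (a : A x'), TotalSpace.mk' F x (h ▸ a) = TotalSpace.mk' F x' a := by
      rintro x' rfl a; rfl
    simp only [ξ₀, dif_pos hx]
    exact this _ hx _
  have hcont : ContinuousOn θ θ.source := θ.contMDiffOn.continuousOn
  have hUo : IsOpen (θ.source ∩ θ ⁻¹' V) := hcont.isOpen_inter_preimage θ.open_source hV
  have hyt : θ (φ y) = y := hleft y (hφ y).localInverse_mem_target
  have hyU : φ y ∈ θ.source ∩ θ ⁻¹' V :=
    ⟨(hφ y).localInverse_mem_source, by rw [Set.mem_preimage, hyt]; exact hy⟩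
  have hsm : ContMDiffOn 𝓘(ℝ, E) (𝓘(ℝ, E).prod 𝓘(ℝ, F)) ∞ (fun x => TotalSpace.mk' F x (ξ₀ x))
      (θ.source ∩ θ ⁻¹' V) := by
    have h2 : ContMDiffOn 𝓘(ℝ, E) (𝓘(ℝ, E').prod 𝓘(ℝ, F)) ∞
        (fun x => TotalSpace.mk' F (θ x) (σ (θ x))) (θ.source ∩ θ ⁻¹' V) :=
      hσ.comp (θ.contMDiffOn.mono Set.inter_subset_left) Set.inter_subset_right
    intro x hx
    have h3 := (h2.contMDiffAt (hUo.mem_nhds hx))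
    have h4 := ((contMDiffAt_pullback_iff φ _ x).1 h3).2
    refine (h4.congr_of_eventuallyEq ?_).contMDiffWithinAt
    filter_upwards [θ.open_source.mem_nhds hx.1] with w hw
    exact hξ₀ w (hright w hw)
  obtain ⟨η, hη⟩ := exists_section_eventuallyEq hUo hyU hsm
  refine ⟨η, ?_⟩
  filter_upwards [φ.contMDiff.continuous.continuousAt.eventually hη,
    θ.open_target.mem_nhds (hφ y).localInverse_mem_target] with z hz hzt
  rw [hz]
  have h5 := hleft z hzt
  have h6 := hξ₀ (φ z) (by rw [h5])
  have : ∀ w, w = z → TotalSpace.mk' F (φ z) (ξ₀ (φ z)) =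
      Pullback.lift φ (TotalSpace.mk' F w (σ w)) → σ z = ξ₀ (φ z) := by
    rintro w rfl h
    exact (eq_of_heq (TotalSpace.mk.inj h).2).symm
  exact this _ h5 h6

theorem exists_function_of_pullback [FiniteDimensional ℝ E] [T2Space X]
    (hφ : IsLocalDiffeomorph 𝓘(ℝ, E') 𝓘(ℝ, E) ∞ φ) (y : Y)
    (f : C^∞⟮𝓘(ℝ, E'), Y; 𝓘(ℝ, ℝ), ℝ⟯) :
    ∃ k : C^∞⟮𝓘(ℝ, E), X; 𝓘(ℝ, ℝ), ℝ⟯, ∀ᶠ z in 𝓝 y, f z = k (φ z) := by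
  set θ := (hφ y).localInverse with hθ
  obtain ⟨k, hk⟩ := exists_function_eventuallyEq (E := E) θ.open_source
    (hφ y).localInverse_mem_source (f.contMDiff.comp_contMDiffOn θ.contMDiffOn)
  refine ⟨k, ?_⟩
  filter_upwards [φ.contMDiff.continuous.continuousAt.eventually hk,
    θ.open_target.mem_nhds (hφ y).localInverse_mem_target] with z hz hzt
  rw [hz]
  simp [hθ, (hφ y).localInverse_left_inv hzt]

theorem dirDeriv_comp {y : Y}
    {f : C^∞⟮𝓘(ℝ, E'), Y; 𝓘(ℝ, ℝ), ℝ⟯} {k : C^∞⟮𝓘(ℝ, E), X; 𝓘(ℝ, ℝ), ℝ⟯}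
    (h : ∀ᶠ z in 𝓝 y, f z = k (φ z)) (v : TangentSpace 𝓘(ℝ, E') y) :
    dirDeriv f y v = dirDeriv k (φ y) (mfderiv 𝓘(ℝ, E') 𝓘(ℝ, E) φ y v) := by
  have h1 : mfderiv 𝓘(ℝ, E') 𝓘(ℝ, ℝ) f y = mfderiv 𝓘(ℝ, E') 𝓘(ℝ, ℝ) (k ∘ φ) y :=
    Filter.EventuallyEq.mfderiv_eq h
  have h2 : mfderiv 𝓘(ℝ, E') 𝓘(ℝ, ℝ) (k ∘ φ) y = (mfderiv 𝓘(ℝ, E) 𝓘(ℝ, ℝ) k (φ y)).comp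
      (mfderiv 𝓘(ℝ, E') 𝓘(ℝ, E) φ y) :=
    mfderiv_comp y (k.contMDiff.mdifferentiable (by simp) _)
      (φ.contMDiff.mdifferentiable (by simp) _)
  unfold dirDeriv
  have h3 := congrArg (fun T : E' →L[ℝ] ℝ => T v) (h1.trans h2)
  exact h3

namespace LieAlgebroid

variable (L : LieAlgebroid E F A)

variable (φ) in
/-- A section of the pullback Lie algebroid
`φ^!A = {(v, w) ∈ TY ⊕ φ^*A | φ_* v = a(w)}`. -/
structure ShriekSection where
  vec : Cₛ^∞⟮𝓘(ℝ, E'); E', (TangentSpace 𝓘(ℝ, E') : Y → Type _)⟯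
  sec : Cₛ^∞⟮𝓘(ℝ, E'); F, ((φ : Y → X) *ᵖ A)⟯
  compat : ∀ y, mfderiv 𝓘(ℝ, E') 𝓘(ℝ, E) φ y (vec y) = L.anchor (φ y) (sec y)

/-- A presentation `σ = ∑ i, fᵢ ⊗ ξᵢ = ∑ i, fᵢ (φ^*ξᵢ)` near `y`. -/
structure LocalPresentation (σ : Cₛ^∞⟮𝓘(ℝ, E'); F, ((φ : Y → X) *ᵖ A)⟯) (y : Y) where
  n : ℕ
  coeff : Fin n → C^∞⟮𝓘(ℝ, E'), Y; 𝓘(ℝ, ℝ), ℝ⟯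
  sec : Fin n → Cₛ^∞⟮𝓘(ℝ, E); F, A⟯
  eventually_eq : ∀ᶠ z in 𝓝 y, σ z = ∑ i, coeff i z • (sec i (φ z) : A (φ z))

variable {L} in
/-- The value `∑ fᵢ f'ⱼ ⊗ [ξᵢ, ξ'ⱼ] + ∑ v(f'ⱼ) ⊗ ξ'ⱼ - ∑ v'(fᵢ) ⊗ ξᵢ` at `y`. -/
def shriekFormula {p q : L.ShriekSection φ} {y : Y} (P : LocalPresentation p.sec y)
    (Q : LocalPresentation q.sec y) : A (φ y) :=
  (∑ i, ∑ j, (P.coeff i y * Q.coeff j y) • L.bracket (P.sec i) (Q.sec j) (φ y))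
    + (∑ j, dirDeriv (Q.coeff j) y (p.vec y) • Q.sec j (φ y))
    - ∑ i, dirDeriv (P.coeff i) y (q.vec y) • P.sec i (φ y)

variable {L} in
/-- `r` is the Lie bracket of the sections `p = v ⊕ ∑ fᵢ ⊗ ξᵢ` and `q = v' ⊕ ∑ f'ⱼ ⊗ ξ'ⱼ` of `φ^!A`,
`[p, q] = [v, v'] ⊕ (∑ fᵢ f'ⱼ ⊗ [ξᵢ, ξ'ⱼ] + ∑ v(f'ⱼ) ⊗ ξ'ⱼ - ∑ v'(fᵢ) ⊗ ξᵢ)`. -/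
structure IsShriekBracket (p q r : L.ShriekSection φ) : Prop where
  vec_eq : ∀ y, r.vec y = VectorField.mlieBracket 𝓘(ℝ, E') p.vec q.vec y
  sec_eq : ∀ y (P : LocalPresentation p.sec y) (Q : LocalPresentation q.sec y),
    r.sec y = shriekFormula P Q

/-- The section `∑ i, kᵢ ξᵢ`. -/
def sumSection {n : ℕ} (k : Fin n → C^∞⟮𝓘(ℝ, E), X; 𝓘(ℝ, ℝ), ℝ⟯)
    (ξ : Fin n → Cₛ^∞⟮𝓘(ℝ, E); F, A⟯) : Cₛ^∞⟮𝓘(ℝ, E); F, A⟯ :=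
  ∑ i, smulSection (k i) (ξ i)

theorem sumSection_apply {n : ℕ} (k : Fin n → C^∞⟮𝓘(ℝ, E), X; 𝓘(ℝ, ℝ), ℝ⟯)
    (ξ : Fin n → Cₛ^∞⟮𝓘(ℝ, E); F, A⟯) (x : X) : sumSection k ξ x = ∑ i, k i x • ξ i x := by
  have := map_sum (ContMDiffSection.coeAddHom 𝓘(ℝ, E) F ∞ A) (fun i => smulSection (k i) (ξ i))
    Finset.univ
  have h2 := congrFun this x
  rw [Finset.sum_apply] at h2
  exact h2

theorem dirDeriv_sum {ι : Type*} (s : Finset ι) (f : C^∞⟮𝓘(ℝ, E), X; 𝓘(ℝ, ℝ), ℝ⟯) (x : X)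
    (c : ι → ℝ) (v : ι → TangentSpace 𝓘(ℝ, E) x) :
    dirDeriv f x (∑ i ∈ s, c i • v i) = ∑ i ∈ s, c i * dirDeriv f x (v i) := by
  have := map_sum (mfderiv 𝓘(ℝ, E) 𝓘(ℝ, ℝ) f x : E →L[ℝ] ℝ) (fun i => c i • (v i : E)) s
  refine this.trans (Finset.sum_congr rfl fun i _ => ?_)
  exact map_smul (mfderiv 𝓘(ℝ, E) 𝓘(ℝ, ℝ) f x : E →L[ℝ] ℝ) _ _

theorem sum_apply_section {ι : Type*} (s : Finset ι) (ξ : ι → Cₛ^∞⟮𝓘(ℝ, E); F, A⟯) (x : X) :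
    (∑ i ∈ s, ξ i) x = ∑ i ∈ s, ξ i x := by
  have := congrFun (map_sum (ContMDiffSection.coeAddHom 𝓘(ℝ, E) F ∞ A) ξ s) x
  rw [Finset.sum_apply] at this
  exact this

theorem bracket_smulSection (k l : C^∞⟮𝓘(ℝ, E), X; 𝓘(ℝ, ℝ), ℝ⟯)
    (ξ η : Cₛ^∞⟮𝓘(ℝ, E); F, A⟯) (x : X) :
    L.bracket (smulSection k ξ) (smulSection l η) x =
      (k x * l x) • L.bracket ξ η x + (k x * dirDeriv l x (L.anchor x (ξ x))) • η x
      - (l x * dirDeriv k x (L.anchor x (η x))) • ξ x := by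
  have h : dirDeriv l x (L.anchor x (smulSection k ξ x)) =
      k x * dirDeriv l x (L.anchor x (ξ x)) := by
    have h1 : L.anchor x (smulSection k ξ x) = k x • L.anchor x (ξ x) := map_smul _ _ _
    rw [h1]
    exact map_smul (mfderiv 𝓘(ℝ, E) 𝓘(ℝ, ℝ) l x : E →L[ℝ] ℝ) _ _
  rw [L.leibniz, L.leibniz_left, h]
  module

theorem bracket_sumSection {m n : ℕ} (k : Fin m → C^∞⟮𝓘(ℝ, E), X; 𝓘(ℝ, ℝ), ℝ⟯)
    (ξ : Fin m → Cₛ^∞⟮𝓘(ℝ, E); F, A⟯) (l : Fin n → C^∞⟮𝓘(ℝ, E), X; 𝓘(ℝ, ℝ), ℝ⟯)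
    (η : Fin n → Cₛ^∞⟮𝓘(ℝ, E); F, A⟯) (x : X) :
    L.bracket (sumSection k ξ) (sumSection l η) x =
      (∑ i, ∑ j, (k i x * l j x) • L.bracket (ξ i) (η j) x)
      + (∑ j, dirDeriv (l j) x (L.anchor x (sumSection k ξ x)) • η j x)
      - ∑ i, dirDeriv (k i) x (L.anchor x (sumSection l η x)) • ξ i x := by
  have e : L.bracket (sumSection k ξ) (sumSection l η) x =
      ∑ i, ∑ j, L.bracket (smulSection (k i) (ξ i)) (smulSection (l j) (η j)) x := by
    unfold sumSection
    simp only [map_sum, LinearMap.sum_apply, sum_apply_section]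
    exact Finset.sum_comm
  rw [e]
  simp only [bracket_smulSection, Finset.sum_sub_distrib, Finset.sum_add_distrib, sumSection_apply,
    map_sum, map_smul, dirDeriv_sum, Finset.sum_smul]
  congr 1
  congr 1
  exact Finset.sum_comm

variable {L}

theorem eventually_nhds_of_pullback (hφ : IsLocalDiffeomorph 𝓘(ℝ, E') 𝓘(ℝ, E) ∞ φ) {y : Y}
    {p : X → Prop} (h : ∀ᶠ z in 𝓝 y, p (φ z)) : ∀ᶠ x in 𝓝 (φ y), p x := by
  rw [← hφ.isLocalHomeomorph.map_nhds_eq y]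
  exact h

section T2

variable [FiniteDimensional ℝ E] [T2Space X]

theorem shriekFormula_eq (hφ : IsLocalDiffeomorph 𝓘(ℝ, E') 𝓘(ℝ, E) ∞ φ)
    {p q : L.ShriekSection φ} {y : Y} (P : LocalPresentation p.sec y)
    (Q : LocalPresentation q.sec y) {ξ η : Cₛ^∞⟮𝓘(ℝ, E); F, A⟯}
    (hξ : ∀ᶠ z in 𝓝 y, p.sec z = ξ (φ z)) (hη : ∀ᶠ z in 𝓝 y, q.sec z = η (φ z)) :
    shriekFormula P Q = L.bracket ξ η (φ y) := by
  choose k hk using fun i => exists_function_of_pullback hφ y (P.coeff i)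
  choose l hl using fun i => exists_function_of_pullback hφ y (Q.coeff i)
  have hp : ∀ᶠ z in 𝓝 y, p.sec z = sumSection k P.sec (φ z) := by
    filter_upwards [P.eventually_eq, eventually_all.2 hk] with z h1 h2
    rw [h1, sumSection_apply]
    simp only [h2]
    rfl
  have hq : ∀ᶠ z in 𝓝 y, q.sec z = sumSection l Q.sec (φ z) := by
    filter_upwards [Q.eventually_eq, eventually_all.2 hl] with z h1 h2
    rw [h1, sumSection_apply]
    simp only [h2]
    rfl
  have e1 : ∀ᶠ x in 𝓝 (φ y), ξ x = sumSection k P.sec x :=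
    eventually_nhds_of_pullback hφ (by filter_upwards [hξ, hp] with z h1 h2; rw [← h1, ← h2])
  have e2 : ∀ᶠ x in 𝓝 (φ y), η x = sumSection l Q.sec x :=
    eventually_nhds_of_pullback hφ (by filter_upwards [hη, hq] with z h1 h2; rw [← h1, ← h2])
  rw [(L.bracket_congr e1 e2).self_of_nhds, bracket_sumSection]
  unfold shriekFormula
  simp only [dirDeriv_comp (hl _), dirDeriv_comp (hk _), p.compat, q.compat,
    fun i => (hk i).self_of_nhds, fun i => (hl i).self_of_nhds]
  rw [hp.self_of_nhds, hq.self_of_nhds]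

/-- The one-term presentation `σ = 1 ⊗ ξ`. -/
def LocalPresentation.single {σ : Cₛ^∞⟮𝓘(ℝ, E'); F, ((φ : Y → X) *ᵖ A)⟯} {y : Y}
    {ξ : Cₛ^∞⟮𝓘(ℝ, E); F, A⟯} (h : ∀ᶠ z in 𝓝 y, σ z = ξ (φ z)) : LocalPresentation σ y where
  n := 1
  coeff := fun _ => 1
  sec := fun _ => ξ
  eventually_eq := h.mono fun z hz => by
    rw [hz]; simp; rfl

theorem exists_rep (hφ : IsLocalDiffeomorph 𝓘(ℝ, E') 𝓘(ℝ, E) ∞ φ)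
    (σ : Cₛ^∞⟮𝓘(ℝ, E'); F, ((φ : Y → X) *ᵖ A)⟯) (y : Y) :
    ∃ ξ : Cₛ^∞⟮𝓘(ℝ, E); F, A⟯, ∀ᶠ z in 𝓝 y, σ z = ξ (φ z) :=
  exists_section_of_pullback hφ isOpen_univ (Set.mem_univ y) σ.contMDiff.contMDiffOn

theorem ShriekSection.vec_eq_mpullback (hφ : IsLocalDiffeomorph 𝓘(ℝ, E') 𝓘(ℝ, E) ∞ φ)
    (p : L.ShriekSection φ) {z : Y} {ξ : Cₛ^∞⟮𝓘(ℝ, E); F, A⟯} (h : p.sec z = ξ (φ z)) :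
    p.vec z = VectorField.mpullback 𝓘(ℝ, E') 𝓘(ℝ, E) φ (fun x => L.anchor x (ξ x)) z := by
  have h1 := p.compat z
  rw [h] at h1
  rw [VectorField.mpullback_apply, ← h1]
  have h2 := hφ.mfderivToContinuousLinearEquiv_coe (by simp) z
  rw [← h2]
  simp

variable [FiniteDimensional ℝ E']

theorem mfderiv_mlieBracket_vec (hφ : IsLocalDiffeomorph 𝓘(ℝ, E') 𝓘(ℝ, E) ∞ φ)
    (p q : L.ShriekSection φ) {y : Y} {ξ η : Cₛ^∞⟮𝓘(ℝ, E); F, A⟯}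
    (hξ : ∀ᶠ z in 𝓝 y, p.sec z = ξ (φ z)) (hη : ∀ᶠ z in 𝓝 y, q.sec z = η (φ z)) :
    mfderiv 𝓘(ℝ, E') 𝓘(ℝ, E) φ y (VectorField.mlieBracket 𝓘(ℝ, E') p.vec q.vec y) =
      L.anchor (φ y) (L.bracket ξ η (φ y)) := by
  have : IsManifold 𝓘(ℝ, E) (minSmoothness ℝ 2) X := isManifold_minSmoothness
  have : IsManifold 𝓘(ℝ, E') (minSmoothness ℝ 2) Y := isManifold_minSmoothness
  have e1 : ∀ᶠ z in 𝓝 y, p.vec z = _ := hξ.mono fun z hz => p.vec_eq_mpullback hφ hz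
  have e2 : ∀ᶠ z in 𝓝 y, q.vec z = _ := hη.mono fun z hz => q.vec_eq_mpullback hφ hz
  have hA : ∀ ξ : Cₛ^∞⟮𝓘(ℝ, E); F, A⟯, MDifferentiableAt 𝓘(ℝ, E) (𝓘(ℝ, E).prod 𝓘(ℝ, E))
      (fun x => (⟨x, L.anchor x (ξ x)⟩ : TangentBundle 𝓘(ℝ, E) X)) (φ y) := fun ξ =>
    ((L.contMDiff_anchor.comp ξ.contMDiff).mdifferentiable (by simp)) _
  rw [Filter.EventuallyEq.mlieBracket_vectorField_eq e1 e2,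
    ← VectorField.mpullback_mlieBracket (n := ∞) (hA ξ) (hA η) φ.contMDiff.contMDiffAt
      (by simpa using two_le_infty), L.anchor_bracket, VectorField.mpullback_apply]
  have h2 := hφ.mfderivToContinuousLinearEquiv_coe (by simp) y
  rw [← h2]
  simp

theorem existsUnique_shriekBracket (hφ : IsLocalDiffeomorph 𝓘(ℝ, E') 𝓘(ℝ, E) ∞ φ)
    (p q : L.ShriekSection φ) : ∃! r : L.ShriekSection φ, IsShriekBracket p q r := by
  choose ξ hξ using fun y => exists_rep hφ p.sec y
  choose η hη using fun y => exists_rep hφ q.sec y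
  have hloc : ∀ y, ∀ᶠ z in 𝓝 y,
      L.bracket (ξ z) (η z) (φ z) = L.bracket (ξ y) (η y) (φ z) := by
    intro y
    filter_upwards [(hξ y).eventually_nhds, (hη y).eventually_nhds] with z h1 h2
    refine (L.bracket_congr (eventually_nhds_of_pullback hφ ?_)
      (eventually_nhds_of_pullback hφ ?_)).self_of_nhds
    · filter_upwards [h1, hξ z] with w h3 h4
      rw [← h3, ← h4]
    · filter_upwards [h2, hη z] with w h3 h4
      rw [← h3, ← h4]
  refine ⟨⟨⟨VectorField.mlieBracket 𝓘(ℝ, E') p.vec q.vec, fun y => ?_⟩,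
    ⟨fun y => L.bracket (ξ y) (η y) (φ y), fun y => ?_⟩, fun y => ?_⟩, ⟨fun y => ?_, fun y P Q => ?_⟩, ?_⟩
  · have : IsManifold 𝓘(ℝ, E') (((⊤ : ℕ∞) : WithTop ℕ∞) + 1) Y :=
      IsManifold.of_le (n := ∞) (by simp)
    have : IsManifold 𝓘(ℝ, E') (minSmoothness ℝ 2) Y := isManifold_minSmoothness
    exact ContMDiffAt.mlieBracket_vectorField (n := ⊤) (m := ⊤) p.vec.contMDiff.contMDiffAt
      q.vec.contMDiff.contMDiffAt (by simp)
  · refine ((pullbackSection φ (L.bracket (ξ y) (η y))).contMDiff y).congr_of_eventuallyEq ?_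
    filter_upwards [hloc y] with z hz
    rw [hz]; rfl
  · exact mfderiv_mlieBracket_vec hφ p q (hξ y) (hη y)
  · rfl
  · exact (shriekFormula_eq hφ P Q (hξ y) (hη y)).symm
  · rintro ⟨v, s, hc⟩ ⟨h1, h2⟩
    congr 1
    · ext y
      exact h1 y
    · ext y
      exact (h2 y (.single (hξ y)) (.single (hη y))).trans (shriekFormula_eq hφ _ _ (hξ y) (hη y))

/-- The Lie bracket of sections of `φ^!A`: the unique section given by the formula in
`IsShriekBracket` for all presentations of the two sections. -/
def ShriekSection.bracket (hφ : IsLocalDiffeomorph 𝓘(ℝ, E') 𝓘(ℝ, E) ∞ φ)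
    (p q : L.ShriekSection φ) : L.ShriekSection φ :=
  (existsUnique_shriekBracket hφ p q).choose

theorem ShriekSection.bracket_spec (hφ : IsLocalDiffeomorph 𝓘(ℝ, E') 𝓘(ℝ, E) ∞ φ)
    (p q : L.ShriekSection φ) : IsShriekBracket p q (p.bracket hφ q) :=
  (existsUnique_shriekBracket hφ p q).choose_spec.1

theorem ShriekSection.bracket_sec_apply (hφ : IsLocalDiffeomorph 𝓘(ℝ, E') 𝓘(ℝ, E) ∞ φ)
    (p q : L.ShriekSection φ) {y : Y} {ξ η : Cₛ^∞⟮𝓘(ℝ, E); F, A⟯}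
    (hξ : ∀ᶠ z in 𝓝 y, p.sec z = ξ (φ z)) (hη : ∀ᶠ z in 𝓝 y, q.sec z = η (φ z)) :
    (p.bracket hφ q).sec y = L.bracket ξ η (φ y) :=
  ((p.bracket_spec hφ q).sec_eq y (.single hξ) (.single hη)).trans
    (shriekFormula_eq hφ _ _ hξ hη)

end T2


theorem etaleAnchor_contMDiff (hφ : IsLocalDiffeomorph 𝓘(ℝ, E') 𝓘(ℝ, E) ∞ φ) :
    ContMDiff (𝓘(ℝ, E').prod 𝓘(ℝ, F)) (𝓘(ℝ, E').prod 𝓘(ℝ, E')) ∞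
      (fun p : TotalSpace F ((φ : Y → X) *ᵖ A) =>
        (⟨p.1, (hφ.mfderivToContinuousLinearEquiv (by simp) p.1).symm (L.anchor (φ p.1) p.2)⟩ :
          TangentBundle 𝓘(ℝ, E') Y)) := by
  intro p₀
  have hlift : ContMDiff (𝓘(ℝ, E').prod 𝓘(ℝ, F)) (𝓘(ℝ, E).prod 𝓘(ℝ, F)) ∞
      (Pullback.lift φ : TotalSpace F ((φ : Y → X) *ᵖ A) → TotalSpace F A) := fun p =>
    ((contMDiffAt_pullback_iff φ id p).1 contMDiffAt_id).2
  have ha := L.contMDiff_anchor.comp hlift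
  set θ := (hφ p₀.1).localInverse with hθ
  have hs : φ p₀.1 ∈ θ.source := (hφ p₀.1).localInverse_mem_source
  have ht : p₀.1 ∈ θ.target := (hφ p₀.1).localInverse_mem_target
  have h1 : ContMDiffOn (𝓘(ℝ, E).prod 𝓘(ℝ, E)) (𝓘(ℝ, E').prod 𝓘(ℝ, E')) ∞
      (tangentMapWithin 𝓘(ℝ, E) 𝓘(ℝ, E') θ θ.source)
      (TotalSpace.proj ⁻¹' θ.source : Set (TangentBundle 𝓘(ℝ, E) X)) :=
    θ.contMDiffOn.contMDiffOn_tangentMapWithin (by simp) θ.open_source.uniqueMDiffOn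
  have ho : IsOpen (TotalSpace.proj ⁻¹' θ.source : Set (TangentBundle 𝓘(ℝ, E) X)) :=
    θ.open_source.preimage (FiberBundle.continuous_proj E _)
  refine ((h1.contMDiffAt (ho.mem_nhds hs)).comp p₀ ha.contMDiffAt).congr_of_eventuallyEq ?_
  have hpt : ∀ᶠ p : TotalSpace F ((φ : Y → X) *ᵖ A) in 𝓝 p₀, p.1 ∈ θ.target :=
    (Pullback.continuous_proj F A φ).continuousAt.eventually (θ.open_target.mem_nhds ht)
  filter_upwards [hpt] with p hp
  have hl : θ (φ p.1) = p.1 := (hφ p₀.1).localInverse_left_inv hp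
  have hsrc : φ p.1 ∈ θ.source := by
    have := θ.map_target hp
    have h2 : θ.symm p.1 ∈ θ.source := this
    have h3 : φ p.1 = θ.symm p.1 := by
      have h4 := (hφ p₀.1).localInverse_right_inv h2
      have h5 : θ (θ.symm p.1) = p.1 := θ.right_inv hp
      rw [← h4]; exact congrArg φ h5.symm
    rw [h3]; exact h2
  have key : ∀ (z z' : Y) (_ : z = z') (v v' : E') (_ : v = v'),
      (⟨z, v⟩ : TangentBundle 𝓘(ℝ, E') Y) = ⟨z', v'⟩ := by
    rintro z _ rfl v _ rfl; rfl
  refine key _ _ hl.symm _ _ ?_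
  have hd : mfderivWithin 𝓘(ℝ, E) 𝓘(ℝ, E') θ θ.source (φ p.1) =
      mfderiv 𝓘(ℝ, E) 𝓘(ℝ, E') θ (φ p.1) :=
    mfderivWithin_of_isOpen θ.open_source hsrc
  have hc : (mfderiv 𝓘(ℝ, E) 𝓘(ℝ, E') θ (φ p.1)).comp (mfderiv 𝓘(ℝ, E') 𝓘(ℝ, E) φ p.1) =
      mfderiv 𝓘(ℝ, E') 𝓘(ℝ, E') (θ ∘ φ) p.1 :=
    (mfderiv_comp p.1 (θ.mdifferentiableAt (by simp) hsrc)
      (φ.contMDiff.mdifferentiable (by simp) _)).symm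
  have hid : mfderiv 𝓘(ℝ, E') 𝓘(ℝ, E') (θ ∘ φ) p.1 = mfderiv 𝓘(ℝ, E') 𝓘(ℝ, E') id p.1 :=
    Filter.EventuallyEq.mfderiv_eq (by
      filter_upwards [θ.open_target.mem_nhds hp] with z hz
      exact (hφ p₀.1).localInverse_left_inv hz)
  set T := hφ.mfderivToContinuousLinearEquiv (by simp) p.1 with hT
  set w := L.anchor (φ p.1) p.2 with hw
  have hTw : mfderiv 𝓘(ℝ, E') 𝓘(ℝ, E) φ p.1 (T.symm w) = w := T.apply_symm_apply w
  have e1 := congrArg (fun S : E' →L[ℝ] E' => S (T.symm w)) (hc.trans hid)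
  rw [mfderiv_id] at e1
  change T.symm w = mfderivWithin 𝓘(ℝ, E) 𝓘(ℝ, E') θ θ.source (φ p.1) w
  rw [hd]
  conv_rhs => rw [← hTw]
  exact e1.symm

variable (L) in
/-- The isomorphism `φ^*A → φ^!A`, `(y, w) ↦ ((φ_*|_y)⁻¹ a(w), w)`, on sections. -/
def toShriek (hφ : IsLocalDiffeomorph 𝓘(ℝ, E') 𝓘(ℝ, E) ∞ φ)
    (σ : Cₛ^∞⟮𝓘(ℝ, E'); F, ((φ : Y → X) *ᵖ A)⟯) : L.ShriekSection φ where
  vec := ⟨fun y => (hφ.mfderivToContinuousLinearEquiv (by simp) y).symm (L.anchor (φ y) (σ y)),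
    (etaleAnchor_contMDiff (L := L) hφ).comp σ.contMDiff⟩
  sec := σ
  compat := fun y =>
    (hφ.mfderivToContinuousLinearEquiv (by simp) y).apply_symm_apply (L.anchor (φ y) (σ y))

section T2

variable [FiniteDimensional ℝ E] [T2Space X] [FiniteDimensional ℝ E']

variable (L) in
/-- The bracket on `Γ(φ^*A)` transported from `Γ(φ^!A)` along `φ^*A ≅ φ^!A`. -/
def etaleBracket (hφ : IsLocalDiffeomorph 𝓘(ℝ, E') 𝓘(ℝ, E) ∞ φ)
    (σ τ : Cₛ^∞⟮𝓘(ℝ, E'); F, ((φ : Y → X) *ᵖ A)⟯) : Cₛ^∞⟮𝓘(ℝ, E'); F, ((φ : Y → X) *ᵖ A)⟯ :=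
  ((L.toShriek hφ σ).bracket hφ (L.toShriek hφ τ)).sec

theorem etaleBracket_apply (hφ : IsLocalDiffeomorph 𝓘(ℝ, E') 𝓘(ℝ, E) ∞ φ)
    (σ τ : Cₛ^∞⟮𝓘(ℝ, E'); F, ((φ : Y → X) *ᵖ A)⟯) {y : Y} {ξ η : Cₛ^∞⟮𝓘(ℝ, E); F, A⟯}
    (hξ : ∀ᶠ z in 𝓝 y, σ z = ξ (φ z)) (hη : ∀ᶠ z in 𝓝 y, τ z = η (φ z)) :
    L.etaleBracket hφ σ τ y = L.bracket ξ η (φ y) :=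
  ShriekSection.bracket_sec_apply hφ (L.toShriek hφ σ) (L.toShriek hφ τ) hξ hη

theorem etaleBracket_eventuallyEq (hφ : IsLocalDiffeomorph 𝓘(ℝ, E') 𝓘(ℝ, E) ∞ φ)
    (σ τ : Cₛ^∞⟮𝓘(ℝ, E'); F, ((φ : Y → X) *ᵖ A)⟯) {y : Y} {ξ η : Cₛ^∞⟮𝓘(ℝ, E); F, A⟯}
    (hξ : ∀ᶠ z in 𝓝 y, σ z = ξ (φ z)) (hη : ∀ᶠ z in 𝓝 y, τ z = η (φ z)) :
    ∀ᶠ z in 𝓝 y, L.etaleBracket hφ σ τ z = L.bracket ξ η (φ z) := by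
  filter_upwards [hξ.eventually_nhds, hη.eventually_nhds] with z h1 h2
  exact etaleBracket_apply hφ σ τ h1 h2

theorem etaleBracket_jacobi (hφ : IsLocalDiffeomorph 𝓘(ℝ, E') 𝓘(ℝ, E) ∞ φ)
    (σ τ υ : Cₛ^∞⟮𝓘(ℝ, E'); F, ((φ : Y → X) *ᵖ A)⟯) (y : Y) :
    L.etaleBracket hφ σ (L.etaleBracket hφ τ υ) y =
      L.etaleBracket hφ (L.etaleBracket hφ σ τ) υ y +
        L.etaleBracket hφ τ (L.etaleBracket hφ σ υ) y := by
  obtain ⟨ξ, hξ⟩ := exists_rep hφ σ y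
  obtain ⟨η, hη⟩ := exists_rep hφ τ y
  obtain ⟨ζ, hζ⟩ := exists_rep hφ υ y
  rw [etaleBracket_apply hφ _ _ hξ (etaleBracket_eventuallyEq hφ _ _ hη hζ),
    etaleBracket_apply hφ _ _ (etaleBracket_eventuallyEq hφ _ _ hξ hη) hζ,
    etaleBracket_apply hφ _ _ hη (etaleBracket_eventuallyEq hφ _ _ hξ hζ), L.jacobi]
  rfl

theorem etaleBracket_leibniz (hφ : IsLocalDiffeomorph 𝓘(ℝ, E') 𝓘(ℝ, E) ∞ φ)
    (σ : Cₛ^∞⟮𝓘(ℝ, E'); F, ((φ : Y → X) *ᵖ A)⟯) (f : C^∞⟮𝓘(ℝ, E'), Y; 𝓘(ℝ, ℝ), ℝ⟯)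
    (τ : Cₛ^∞⟮𝓘(ℝ, E'); F, ((φ : Y → X) *ᵖ A)⟯) (y : Y) :
    L.etaleBracket hφ σ (smulSection f τ) y =
      dirDeriv f y ((hφ.mfderivToContinuousLinearEquiv (by simp) y).symm (L.anchor (φ y) (σ y))) • τ y
        + f y • L.etaleBracket hφ σ τ y := by
  obtain ⟨ξ, hξ⟩ := exists_rep hφ σ y
  obtain ⟨η, hη⟩ := exists_rep hφ τ y
  have h0 : dirDeriv (1 : C^∞⟮𝓘(ℝ, E'), Y; 𝓘(ℝ, ℝ), ℝ⟯) y
      ((L.toShriek hφ (smulSection f τ)).vec y) = 0 := by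
    unfold dirDeriv
    have : mfderiv 𝓘(ℝ, E') 𝓘(ℝ, ℝ) (fun _ : Y => (1 : ℝ)) y = 0 := mfderiv_const
    exact congrArg (fun T : E' →L[ℝ] ℝ => T _) this
  have hQ : ∀ᶠ z in 𝓝 y, (smulSection f τ) z = ∑ i : Fin 1, f z • (η (φ z) : A (φ z)) := by
    filter_upwards [hη] with z hz
    rw [Fin.sum_univ_one, ← hz]; rfl
  have h := ((L.toShriek hφ σ).bracket_spec hφ
    (L.toShriek hφ (smulSection f τ))).sec_eq y (.single hξ) ⟨1, fun _ => f, fun _ => η, hQ⟩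
  have e := etaleBracket_apply (L := L) hφ _ _ hξ hη
  have hη0 := hη.self_of_nhds
  rw [e, hη0]
  refine h.trans ?_
  unfold shriekFormula
  have hsum : ∀ u : Fin 1 → A (φ y), ∑ i, u i = u 0 := fun u => Fin.sum_univ_one u
  change (∑ i : Fin 1, ∑ j : Fin 1, ((1 : ℝ) * f y) • L.bracket ξ η (φ y) : A (φ y))
    + (∑ j : Fin 1, dirDeriv f y ((L.toShriek hφ σ).vec y) • η (φ y))
    - ∑ i : Fin 1, dirDeriv (1 : C^∞⟮𝓘(ℝ, E'), Y; 𝓘(ℝ, ℝ), ℝ⟯) y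
      ((L.toShriek hφ (smulSection f τ)).vec y) • ξ (φ y) = _
  rw [hsum, hsum, hsum, hsum, h0, zero_smul, sub_zero, one_mul, add_comm]
  rfl

variable (L) in
/-- The Lie algebroid structure on `φ^*A`, for étale `φ`, transported from `φ^!A` along the isomorphism
`φ^*A ≅ φ^!A`, `(y, w) ↦ ((φ_*|_y)⁻¹ a(w), w)`. The anchor of `φ^!A` is the projection `(v, w) ↦ v`. -/
def etalePullback (hφ : IsLocalDiffeomorph 𝓘(ℝ, E') 𝓘(ℝ, E) ∞ φ) :
    LieAlgebroid E' F ((φ : Y → X) *ᵖ A) where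
  anchor := fun y =>
    (hφ.mfderivToContinuousLinearEquiv (by simp) y).symm.toLinearMap ∘ₗ L.anchor (φ y)
  contMDiff_anchor := etaleAnchor_contMDiff hφ
  bracket := LinearMap.mk₂ ℝ (L.etaleBracket hφ)
    (fun σ σ' τ => by
      ext y
      obtain ⟨ξ, hξ⟩ := exists_rep hφ σ y
      obtain ⟨ξ', hξ'⟩ := exists_rep hφ σ' y
      obtain ⟨η, hη⟩ := exists_rep hφ τ y
      have h : ∀ᶠ z in 𝓝 y, (σ + σ') z = (ξ + ξ') (φ z) := by
        filter_upwards [hξ, hξ'] with z h1 h2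
        rw [ContMDiffSection.coe_add, Pi.add_apply, h1, h2]; rfl
      rw [ContMDiffSection.coe_add, Pi.add_apply, etaleBracket_apply hφ _ _ h hη,
        etaleBracket_apply hφ _ _ hξ hη, etaleBracket_apply hφ _ _ hξ' hη, map_add]
      rfl)
    (fun c σ τ => by
      ext y
      obtain ⟨ξ, hξ⟩ := exists_rep hφ σ y
      obtain ⟨η, hη⟩ := exists_rep hφ τ y
      have h : ∀ᶠ z in 𝓝 y, (c • σ) z = (c • ξ) (φ z) := by
        filter_upwards [hξ] with z h1
        rw [ContMDiffSection.coe_smul, Pi.smul_apply, h1]; rfl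
      rw [ContMDiffSection.coe_smul, Pi.smul_apply, etaleBracket_apply hφ _ _ h hη,
        etaleBracket_apply hφ _ _ hξ hη, map_smul]
      rfl)
    (fun σ τ τ' => by
      ext y
      obtain ⟨ξ, hξ⟩ := exists_rep hφ σ y
      obtain ⟨η, hη⟩ := exists_rep hφ τ y
      obtain ⟨η', hη'⟩ := exists_rep hφ τ' y
      have h : ∀ᶠ z in 𝓝 y, (τ + τ') z = (η + η') (φ z) := by
        filter_upwards [hη, hη'] with z h1 h2
        rw [ContMDiffSection.coe_add, Pi.add_apply, h1, h2]; rfl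
      rw [ContMDiffSection.coe_add, Pi.add_apply, etaleBracket_apply hφ _ _ hξ h,
        etaleBracket_apply hφ _ _ hξ hη, etaleBracket_apply hφ _ _ hξ hη', map_add]
      rfl)
    (fun c σ τ => by
      ext y
      obtain ⟨ξ, hξ⟩ := exists_rep hφ σ y
      obtain ⟨η, hη⟩ := exists_rep hφ τ y
      have h : ∀ᶠ z in 𝓝 y, (c • τ) z = (c • η) (φ z) := by
        filter_upwards [hη] with z h1
        rw [ContMDiffSection.coe_smul, Pi.smul_apply, h1]; rfl
      rw [ContMDiffSection.coe_smul, Pi.smul_apply, etaleBracket_apply hφ _ _ hξ h,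
        etaleBracket_apply hφ _ _ hξ hη, map_smul]
      rfl)
  bracket_self := fun σ => by
    ext y
    obtain ⟨ξ, hξ⟩ := exists_rep hφ σ y
    rw [LinearMap.mk₂_apply, etaleBracket_apply hφ _ _ hξ hξ, L.bracket_self]
    rfl
  jacobi := fun σ τ υ => ContMDiffSection.ext fun y => etaleBracket_jacobi hφ σ τ υ y
  anchor_bracket := fun σ τ y => by
    have h1 := ((L.toShriek hφ σ).bracket hφ (L.toShriek hφ τ)).compat y
    have h2 := ((L.toShriek hφ σ).bracket_spec hφ (L.toShriek hφ τ)).vec_eq y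
    rw [h2] at h1
    refine (ContinuousLinearEquiv.symm_apply_eq _).2 ?_
    exact h1.symm
  leibniz := fun σ f τ y => etaleBracket_leibniz hφ σ f τ y

end T2


end LieAlgebroid

end Etale

section Stalks

variable {E : Type*} [NormedAddCommGroup E] [NormedSpace ℝ E]
  {X : Type*} [TopologicalSpace X] [ChartedSpace E X] [IsManifold 𝓘(ℝ, E) ∞ X]
  {F : Type*} [NormedAddCommGroup F] [NormedSpace ℝ F]
  {A : X → Type*} [TopologicalSpace (TotalSpace F A)] [∀ x, TopologicalSpace (A x)]
  [∀ x, AddCommGroup (A x)] [∀ x, Module ℝ (A x)] [FiberBundle F A] [VectorBundle ℝ F A]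

variable (E F A) in
/-- The sections of `A` (extended arbitrarily to all of `X`) that are smooth on an open
neighbourhood of `x`. -/
def sectionsNear (x : X) : Submodule ℝ (∀ z, A z) where
  carrier := {ξ | ∃ U : Set X, IsOpen U ∧ x ∈ U ∧ ContMDiffOn 𝓘(ℝ, E) (𝓘(ℝ, E).prod 𝓘(ℝ, F)) ∞
    (fun z => TotalSpace.mk' F z (ξ z)) U}
  zero_mem' := ⟨Set.univ, isOpen_univ, trivial, (contMDiff_zeroSection ℝ A).contMDiffOn⟩
  add_mem' := by
    rintro ξ η ⟨U, hU, hxU, hξ⟩ ⟨V, hV, hxV, hη⟩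
    exact ⟨U ∩ V, hU.inter hV, ⟨hxU, hxV⟩, (hξ.mono Set.inter_subset_left).add_section
      (hη.mono Set.inter_subset_right)⟩
  smul_mem' := by
    rintro c ξ ⟨U, hU, hxU, hξ⟩
    exact ⟨U, hU, hxU, hξ.const_smul_section⟩

variable (E F A) in
/-- The sections smooth near `x` that vanish near `x`. -/
def nullSections (x : X) : Submodule ℝ (sectionsNear E F A x) where
  carrier := {ξ | ∀ᶠ z in 𝓝 x, ξ.1 z = 0}
  zero_mem' := Eventually.of_forall fun _ => rfl
  add_mem' := by
    intro ξ η hξ hη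
    filter_upwards [hξ, hη] with z h1 h2
    change ξ.1 z + η.1 z = 0
    rw [h1, h2, add_zero]
  smul_mem' := by
    intro c ξ hξ
    filter_upwards [hξ] with z h1
    change c • ξ.1 z = 0
    rw [h1, smul_zero]

variable (E F A) in
/-- The stalk at `x` of the sheaf of smooth sections of `A`. -/
abbrev SectionStalk (x : X) : Type _ := sectionsNear E F A x ⧸ nullSections E F A x

/-- The germ at `x` of a global section. -/
def globalGerm (x : X) : Cₛ^∞⟮𝓘(ℝ, E); F, A⟯ →ₗ[ℝ] SectionStalk E F A x :=
  (nullSections E F A x).mkQ ∘ₗ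
    { toFun := fun ξ => ⟨ξ, Set.univ, isOpen_univ, trivial, ξ.contMDiff.contMDiffOn⟩
      map_add' := fun _ _ => rfl
      map_smul' := fun _ _ => rfl }

theorem globalGerm_eq_iff {x : X} {ξ η : Cₛ^∞⟮𝓘(ℝ, E); F, A⟯} :
    globalGerm x ξ = globalGerm x η ↔ ∀ᶠ z in 𝓝 x, ξ z = η z := by
  refine (Submodule.Quotient.eq _).trans ?_
  refine Filter.eventually_congr (Eventually.of_forall fun z => ?_)
  exact sub_eq_zero

theorem globalGerm_surjective [FiniteDimensional ℝ E] [T2Space X] (x : X) :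
    Function.Surjective (globalGerm x : Cₛ^∞⟮𝓘(ℝ, E); F, A⟯ → SectionStalk E F A x) := by
  intro a
  obtain ⟨⟨ξ, U, hU, hx, hξ⟩, rfl⟩ := Submodule.mkQ_surjective _ a
  obtain ⟨η, hη⟩ := exists_section_eventuallyEq hU hx hξ
  refine ⟨η, (Submodule.Quotient.eq _).2 ?_⟩
  filter_upwards [hη] with z hz
  exact sub_eq_zero.2 hz

namespace LieAlgebroid

/-- The stalk at `x` of the sheaf `𝓐` of sections of the Lie algebroid `L`. -/
def Stalk (_L : LieAlgebroid E F A) (x : X) : Type _ := SectionStalk E F A x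

variable (L : LieAlgebroid E F A) (x : X)

instance : AddCommGroup (L.Stalk x) := inferInstanceAs (AddCommGroup (SectionStalk E F A x))

instance : Module ℝ (L.Stalk x) := inferInstanceAs (Module ℝ (SectionStalk E F A x))

/-- The germ at `x` of a global section of `A`. -/
def germ : Cₛ^∞⟮𝓘(ℝ, E); F, A⟯ →ₗ[ℝ] L.Stalk x := globalGerm x

variable [FiniteDimensional ℝ E] [T2Space X]

theorem germ_surjective : Function.Surjective (L.germ x) := globalGerm_surjective x

/-- The bracket on the stalk induced by the Lie bracket of sections. -/
instance : Bracket (L.Stalk x) (L.Stalk x) where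
  bracket a b := L.germ x (L.bracket (Function.surjInv (L.germ_surjective x) a)
    (Function.surjInv (L.germ_surjective x) b))

theorem germ_bracket (ξ η : Cₛ^∞⟮𝓘(ℝ, E); F, A⟯) :
    ⁅L.germ x ξ, L.germ x η⁆ = L.germ x (L.bracket ξ η) :=
  globalGerm_eq_iff.2 (L.bracket_congr
    (globalGerm_eq_iff.1 (Function.surjInv_eq (L.germ_surjective x) _))
    (globalGerm_eq_iff.1 (Function.surjInv_eq (L.germ_surjective x) _)))

instance : LieRing (L.Stalk x) where
  add_lie := fun a b c => by
    obtain ⟨ξ, rfl⟩ := L.germ_surjective x a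
    obtain ⟨η, rfl⟩ := L.germ_surjective x b
    obtain ⟨ζ, rfl⟩ := L.germ_surjective x c
    simp only [← map_add, germ_bracket]
    rw [map_add, LinearMap.add_apply]
  lie_add := fun a b c => by
    obtain ⟨ξ, rfl⟩ := L.germ_surjective x a
    obtain ⟨η, rfl⟩ := L.germ_surjective x b
    obtain ⟨ζ, rfl⟩ := L.germ_surjective x c
    simp only [← map_add, germ_bracket]
  lie_self := fun a => by
    obtain ⟨ξ, rfl⟩ := L.germ_surjective x a
    rw [germ_bracket, L.bracket_self, map_zero]
  leibniz_lie := fun a b c => by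
    obtain ⟨ξ, rfl⟩ := L.germ_surjective x a
    obtain ⟨η, rfl⟩ := L.germ_surjective x b
    obtain ⟨ζ, rfl⟩ := L.germ_surjective x c
    simp only [germ_bracket, ← map_add]
    rw [L.jacobi]

instance : LieAlgebra ℝ (L.Stalk x) where
  lie_smul := fun c a b => by
    obtain ⟨ξ, rfl⟩ := L.germ_surjective x a
    obtain ⟨η, rfl⟩ := L.germ_surjective x b
    simp only [← map_smul, germ_bracket]

end LieAlgebroid

end Stalks

section StalkMaps

variable {E : Type*} [NormedAddCommGroup E] [NormedSpace ℝ E]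
  {X : Type*} [TopologicalSpace X] [ChartedSpace E X] [IsManifold 𝓘(ℝ, E) ∞ X]
  {F : Type*} [NormedAddCommGroup F] [NormedSpace ℝ F]
  {A : X → Type*} [TopologicalSpace (TotalSpace F A)] [∀ x, TopologicalSpace (A x)]
  [∀ x, AddCommGroup (A x)] [∀ x, Module ℝ (A x)] [FiberBundle F A] [VectorBundle ℝ F A]
  {E' : Type*} [NormedAddCommGroup E'] [NormedSpace ℝ E']
  {Y : Type*} [TopologicalSpace Y] [ChartedSpace E' Y] [IsManifold 𝓘(ℝ, E') ∞ Y]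
  (φ : C^∞⟮𝓘(ℝ, E'), Y; 𝓘(ℝ, E), X⟯)

variable (F A) in
/-- `ξ ↦ φ^*ξ` on sections defined near `φ y`. -/
def pullbackNear (y : Y) :
    sectionsNear E F A (φ y) →ₗ[ℝ] sectionsNear E' F ((φ : Y → X) *ᵖ A) y where
  toFun ξ := ⟨fun z => ξ.1 (φ z), by
    obtain ⟨U, hU, hx, hξ⟩ := ξ.2
    refine ⟨φ ⁻¹' U, hU.preimage φ.contMDiff.continuous, hx, fun z hz => ?_⟩
    exact ((contMDiffAt_pullback_iff φ (fun z => TotalSpace.mk' F z (ξ.1 (φ z))) z).2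
      ⟨contMDiffAt_id, (hξ.contMDiffAt (hU.mem_nhds hz)).comp z
        φ.contMDiff.contMDiffAt⟩).contMDiffWithinAt⟩
  map_add' _ _ := rfl
  map_smul' _ _ := rfl

variable (F A) in
/-- The map of stalks `[ξ]_{φ y} ↦ [φ^*ξ]_y`. -/
def pullbackStalk (y : Y) :
    SectionStalk E F A (φ y) →ₗ[ℝ] SectionStalk E' F ((φ : Y → X) *ᵖ A) y :=
  Submodule.mapQ _ _ (pullbackNear F A φ y) fun _ hξ =>
    φ.contMDiff.continuous.continuousAt.eventually hξ

variable {φ} in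
theorem pullbackStalk_bijective [FiniteDimensional ℝ E] [T2Space X]
    (hφ : IsLocalDiffeomorph 𝓘(ℝ, E') 𝓘(ℝ, E) ∞ φ) (y : Y) :
    Function.Bijective (pullbackStalk F A φ y) := by
  constructor
  · rw [injective_iff_map_eq_zero]
    intro a ha
    obtain ⟨ξ, rfl⟩ := Submodule.mkQ_surjective _ a
    refine (Submodule.Quotient.mk_eq_zero _).2 ?_
    have h := (Submodule.Quotient.mk_eq_zero _).1 ha
    exact LieAlgebroid.eventually_nhds_of_pullback hφ h
  · intro b
    obtain ⟨⟨σ, V, hV, hy, hσ⟩, rfl⟩ := Submodule.mkQ_surjective _ b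
    obtain ⟨ξ, hξ⟩ := exists_section_of_pullback hφ hV hy hσ
    refine ⟨globalGerm (φ y) ξ, (Submodule.Quotient.eq _).2 ?_⟩
    filter_upwards [hξ] with z hz
    exact sub_eq_zero.2 hz.symm

variable (F A) {φ} in
/-- For étale `φ`, the isomorphism `𝓐_{φ y} ≅ (φ^*𝓐)_y` between the stalks of the sheaves of sections
of `A` and of `φ^*A`. -/
def pullbackStalkEquiv [FiniteDimensional ℝ E] [T2Space X]
    (hφ : IsLocalDiffeomorph 𝓘(ℝ, E') 𝓘(ℝ, E) ∞ φ) (y : Y) :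
    SectionStalk E F A (φ y) ≃ₗ[ℝ] SectionStalk E' F ((φ : Y → X) *ᵖ A) y :=
  LinearEquiv.ofBijective (pullbackStalk F A φ y) (pullbackStalk_bijective hφ y)

end StalkMaps

section BundleIso

variable (E : Type*) [NormedAddCommGroup E] [NormedSpace ℝ E]
  {X : Type*} [TopologicalSpace X] [ChartedSpace E X] [IsManifold 𝓘(ℝ, E) ∞ X]
  (F : Type*) [NormedAddCommGroup F] [NormedSpace ℝ F]
  (V : X → Type*) [TopologicalSpace (TotalSpace F V)] [∀ x, TopologicalSpace (V x)]
  [∀ x, AddCommGroup (V x)] [∀ x, Module ℝ (V x)] [FiberBundle F V] [VectorBundle ℝ F V]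
  (W : X → Type*) [TopologicalSpace (TotalSpace F W)] [∀ x, TopologicalSpace (W x)]
  [∀ x, AddCommGroup (W x)] [∀ x, Module ℝ (W x)] [FiberBundle F W] [VectorBundle ℝ F W]

/-- Smooth isomorphisms of vector bundles `V → W` over `X`. -/
structure VectorBundleIso where
  /-- The isomorphisms of the fibres. -/
  toEquiv : ∀ x, V x ≃ₗ[ℝ] W x
  contMDiff_toFun : ContMDiff (𝓘(ℝ, E).prod 𝓘(ℝ, F)) (𝓘(ℝ, E).prod 𝓘(ℝ, F)) ∞
    (fun p : TotalSpace F V => (⟨p.1, toEquiv p.1 p.2⟩ : TotalSpace F W))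
  contMDiff_invFun : ContMDiff (𝓘(ℝ, E).prod 𝓘(ℝ, F)) (𝓘(ℝ, E).prod 𝓘(ℝ, F)) ∞
    (fun p : TotalSpace F W => (⟨p.1, (toEquiv p.1).symm p.2⟩ : TotalSpace F V))

namespace VectorBundleIso

variable {E F V W} (ψ : VectorBundleIso E F V W)

/-- The inverse isomorphism. -/
def symm : VectorBundleIso E F W V where
  toEquiv x := (ψ.toEquiv x).symm
  contMDiff_toFun := ψ.contMDiff_invFun
  contMDiff_invFun := ψ.contMDiff_toFun

/-- The map `Γ(V) → Γ(W)` induced by a vector bundle isomorphism. -/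
def mapSection (ξ : Cₛ^∞⟮𝓘(ℝ, E); F, V⟯) : Cₛ^∞⟮𝓘(ℝ, E); F, W⟯ :=
  ⟨fun x => ψ.toEquiv x (ξ x), ψ.contMDiff_toFun.comp ξ.contMDiff⟩

/-- `ξ ↦ ψ ∘ ξ` on sections defined near `x`. -/
def mapNear (x : X) : sectionsNear E F V x →ₗ[ℝ] sectionsNear E F W x where
  toFun ξ := ⟨fun z => ψ.toEquiv z (ξ.1 z), by
    obtain ⟨U, hU, hx, hξ⟩ := ξ.2
    exact ⟨U, hU, hx, ψ.contMDiff_toFun.comp_contMDiffOn hξ⟩⟩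
  map_add' ξ η := Subtype.ext (funext fun z => map_add (ψ.toEquiv z) _ _)
  map_smul' c ξ := Subtype.ext (funext fun z => map_smul (ψ.toEquiv z) _ _)

/-- The map of stalks `[ξ]_x ↦ [ψ ∘ ξ]_x`. -/
def mapStalk (x : X) : SectionStalk E F V x →ₗ[ℝ] SectionStalk E F W x :=
  Submodule.mapQ _ _ (ψ.mapNear x) fun ξ (hξ : ∀ᶠ z in 𝓝 x, ξ.1 z = 0) =>
    hξ.mono fun z hz => show ψ.toEquiv z (ξ.1 z) = 0 by rw [hz, map_zero]

/-- The isomorphism of stalks `[σ]_x ↦ [ψ ∘ σ]_x`. -/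
def stalkEquiv (x : X) : SectionStalk E F V x ≃ₗ[ℝ] SectionStalk E F W x where
  __ := ψ.mapStalk x
  invFun := ψ.symm.mapStalk x
  left_inv a := by
    obtain ⟨ξ, rfl⟩ := Submodule.mkQ_surjective _ a
    exact congrArg (Submodule.Quotient.mk)
      (Subtype.ext (funext fun z => (ψ.toEquiv z).symm_apply_apply _))
  right_inv a := by
    obtain ⟨ξ, rfl⟩ := Submodule.mkQ_surjective _ a
    exact congrArg (Submodule.Quotient.mk)
      (Subtype.ext (funext fun z => (ψ.toEquiv z).apply_symm_apply _))

/-- `ψ` is a morphism of Lie algebroids over `X`. -/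
structure IsLieAlgebroidHom (L : LieAlgebroid E F V) (M : LieAlgebroid E F W) : Prop where
  anchor_comp : ∀ x (v : V x), M.anchor x (ψ.toEquiv x v) = L.anchor x v
  map_bracket : ∀ ξ η, ψ.mapSection (L.bracket ξ η) =
    M.bracket (ψ.mapSection ξ) (ψ.mapSection η)

/-- `ψ` is an isomorphism of Lie algebroids over `X`. -/
def IsLieAlgebroidIso (L : LieAlgebroid E F V) (M : LieAlgebroid E F W) : Prop :=
  ψ.IsLieAlgebroidHom L M ∧ ψ.symm.IsLieAlgebroidHom M L

end VectorBundleIso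

end BundleIso

section Groupoid

/-- Étale Lie groupoids `G ⇉ X`: groupoids with smooth structure maps whose source and target are
local diffeomorphisms. The product `mul g h` is the composite `g h`, defined if `s(g) = t(h)`. -/
structure EtaleLieGroupoid (E' E : Type*) [NormedAddCommGroup E'] [NormedSpace ℝ E']
    [NormedAddCommGroup E] [NormedSpace ℝ E]
    (G X : Type*) [TopologicalSpace G] [ChartedSpace E' G] [TopologicalSpace X] [ChartedSpace E X]
    where
  source : C^∞⟮𝓘(ℝ, E'), G; 𝓘(ℝ, E), X⟯
  target : C^∞⟮𝓘(ℝ, E'), G; 𝓘(ℝ, E), X⟯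
  unit : C^∞⟮𝓘(ℝ, E), X; 𝓘(ℝ, E'), G⟯
  inv : C^∞⟮𝓘(ℝ, E'), G; 𝓘(ℝ, E'), G⟯
  mul : ∀ g h : G, source g = target h → G
  source_mul : ∀ g h hgh, source (mul g h hgh) = source h
  target_mul : ∀ g h hgh, target (mul g h hgh) = target g
  mul_assoc : ∀ g h k (hgh : source g = target h) (hhk : source h = target k),
    mul (mul g h hgh) k ((source_mul g h hgh).trans hhk) =
      mul g (mul h k hhk) (hgh.trans (target_mul h k hhk).symm)
  source_unit : ∀ x, source (unit x) = x
  target_unit : ∀ x, target (unit x) = x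
  unit_mul : ∀ g, mul (unit (target g)) g (source_unit _) = g
  mul_unit : ∀ g, mul g (unit (source g)) (target_unit _).symm = g
  source_inv : ∀ g, source (inv g) = target g
  target_inv : ∀ g, target (inv g) = source g
  inv_mul : ∀ g, mul (inv g) g (source_inv g) = unit (source g)
  mul_inv : ∀ g, mul g (inv g) (target_inv g).symm = unit (target g)
  /-- The multiplication is smooth on the submanifold of composable pairs of `G × G`: locally it
  extends to a smooth map on an open subset of `G × G`. -/
  smooth_mul : ∀ g h (_ : source g = target h), ∃ U : Set (G × G), IsOpen U ∧ (g, h) ∈ U ∧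
    ∃ m : G × G → G, ContMDiffOn (𝓘(ℝ, E').prod 𝓘(ℝ, E')) 𝓘(ℝ, E') ∞ m U ∧
      ∀ p ∈ U, ∀ hp : source p.1 = target p.2, m p = mul p.1 p.2 hp
  source_etale : IsLocalDiffeomorph 𝓘(ℝ, E') 𝓘(ℝ, E) ∞ source
  target_etale : IsLocalDiffeomorph 𝓘(ℝ, E') 𝓘(ℝ, E) ∞ target

namespace EtaleLieGroupoid

variable {E' E : Type*} [NormedAddCommGroup E'] [NormedSpace ℝ E']
  [NormedAddCommGroup E] [NormedSpace ℝ E]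
  {G X : Type*} [TopologicalSpace G] [ChartedSpace E' G] [IsManifold 𝓘(ℝ, E') ∞ G]
  [TopologicalSpace X] [ChartedSpace E X] [IsManifold 𝓘(ℝ, E) ∞ X]
  {F : Type*} [NormedAddCommGroup F] [NormedSpace ℝ F]
  {A : X → Type*} [TopologicalSpace (TotalSpace F A)] [∀ x, TopologicalSpace (A x)]
  [∀ x, AddCommGroup (A x)] [∀ x, Module ℝ (A x)] [FiberBundle F A] [VectorBundle ℝ F A]
  (𝒢 : EtaleLieGroupoid E' E G X)

/-- The germ at `s(g)` of a diffeomorphism defined by an arrow `g`: `t ∘ (s|_W)⁻¹` for a small open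
neighbourhood `W` of `g`. -/
def germDiffeo (g : G) : X → X := 𝒢.target ∘ (𝒢.source_etale g).localInverse

theorem germDiffeo_source (g : G) : 𝒢.germDiffeo g (𝒢.source g) = 𝒢.target g :=
  congrArg 𝒢.target ((𝒢.source_etale g).localInverse_left_inv
    (𝒢.source_etale g).localInverse_mem_target)

/-- The natural action of the groupoid on `TX`, `v ↦ (t ∘ (s|_W)⁻¹)_* v`. -/
def tangentAction (g : G) :
    TangentSpace 𝓘(ℝ, E) (𝒢.source g) →L[ℝ] TangentSpace 𝓘(ℝ, E) (𝒢.target g) :=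
  mfderiv 𝓘(ℝ, E) 𝓘(ℝ, E) (𝒢.germDiffeo g) (𝒢.source g)

variable (ψ : VectorBundleIso E' F ((𝒢.source : G → X) *ᵖ A) ((𝒢.target : G → X) *ᵖ A))

variable {𝒢} in
/-- The linear map `A_{s(g)} → A_{t(g)}` by which `g` acts. -/
def fiberAct (g : G) : A (𝒢.source g) ≃ₗ[ℝ] A (𝒢.target g) := ψ.toEquiv g

variable {𝒢} in
/-- The action on the total space: `a ∈ A_{s(g)}` goes to `g a ∈ A_{t(g)}`. -/
def act (g : G) (a : TotalSpace F A) (ha : 𝒢.source g = a.proj) : TotalSpace F A :=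
  ⟨𝒢.target g, fiberAct ψ g (ha ▸ a.2)⟩

variable {𝒢} in
/-- The cocycle condition `ψ_{gh} = ψ_g ∘ ψ_h`. -/
def IsCocycle : Prop :=
  ∀ (g h : G) (hgh : 𝒢.source g = 𝒢.target h) (a : TotalSpace F A) (ha : 𝒢.source h = a.proj),
    act ψ (𝒢.mul g h hgh) a ((𝒢.source_mul g h hgh).trans ha) = act ψ g (act ψ h a ha) hgh

variable {𝒢} in
/-- The anchor `A → TX` is equivariant: `a(g v) = g a(v)`. -/
def IsEquivariantAnchor (L : LieAlgebroid E F A) : Prop :=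
  ∀ (g : G) (a : A (𝒢.source g)),
    L.anchor (𝒢.target g) (fiberAct ψ g a) = 𝒢.tangentAction g (L.anchor (𝒢.source g) a)

variable [FiniteDimensional ℝ E] [T2Space X]

variable {𝒢} in
/-- The action of the groupoid on the sheaf `𝓐` of sections of `A`: the arrow `g` acts on stalks by
`𝓐_{s(g)} ≅ (s^*𝓐)_g ≅ (t^*𝓐)_g ≅ 𝓐_{t(g)}`, where the isomorphism in the middle is given by `ψ`. So
the germ of `ξ` is mapped to the germ of `ζ` if `ψ (s^*ξ) = t^*ζ` near `g`, that is, if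
`ζ = L_W(ξ)` for a small bisection `W` through `g`. -/
def stalkAct (L : LieAlgebroid E F A) (g : G) :
    L.Stalk (𝒢.source g) ≃ₗ[ℝ] L.Stalk (𝒢.target g) :=
  (pullbackStalkEquiv F A 𝒢.source_etale g ≪≫ₗ ψ.stalkEquiv g ≪≫ₗ
    (pullbackStalkEquiv F A 𝒢.target_etale g).symm :
    SectionStalk E F A (𝒢.source g) ≃ₗ[ℝ] SectionStalk E F A (𝒢.target g))

variable {𝒢} in
theorem stalkAct_germ_eq_iff (L : LieAlgebroid E F A) (g : G) (ξ ζ : Cₛ^∞⟮𝓘(ℝ, E); F, A⟯) :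
    stalkAct ψ L g (L.germ _ ξ) = L.germ _ ζ ↔
      ∀ᶠ z in 𝓝 g, fiberAct ψ z (ξ (𝒢.source z)) = ζ (𝒢.target z) := by
  refine (LinearEquiv.symm_apply_eq (pullbackStalkEquiv F A 𝒢.target_etale g)).trans ?_
  refine (Submodule.Quotient.eq _).trans ?_
  exact Filter.eventually_congr (Eventually.of_forall fun z => sub_eq_zero)

variable {𝒢} in
/-- The sheaf `𝓐` of sections of `A` is a sheaf of Lie algebras for the groupoid: each arrow `g` acts
as an isomorphism of Lie algebras `𝓐_{s(g)} → 𝓐_{t(g)}`. -/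
def IsSheafOfLieAlgebras (L : LieAlgebroid E F A) : Prop :=
  ∀ g : G, ∃ e : L.Stalk (𝒢.source g) ≃ₗ⁅ℝ⁆ L.Stalk (𝒢.target g),
    ∀ a, e a = stalkAct ψ L g a

end EtaleLieGroupoid
end Groupoid

end

/-!
The statement is local on `G`, and both halves of it are translations along the local
diffeomorphisms `s` and `t`.

* Anchors. Since `s` and `t` are étale, the arrow `g` acts on `TX` by `t_* ∘ (s_*|_g)⁻¹`
  (`tangentAction_apply`). The anchors of `s^*A` and `t^*A` are `(s_*)⁻¹ ∘ a` and `(t_*)⁻¹ ∘ a`, so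
  `ψ` commutes with them exactly if `a` is equivariant
  (`etalePullback_anchor_comp_iff_isEquivariantAnchor`).
* Brackets. Near `g` every section of `s^*A` is `s^*ξ` for some `ξ ∈ Γ(A)`, its image under `ψ` is
  `t^*ξ'` for some `ξ' ∈ Γ(A)`, and then `g` maps the germ of `ξ` to the germ of `ξ'`
  (`stalkAct_germ_eq_of_rep`). On pulled back sections the brackets are `[s^*ξ, s^*η] = s^*[ξ, η]`
  and `[t^*ξ', t^*η'] = t^*[ξ', η']`, so `ψ` preserves brackets near `g` exactly if the action of `g`
  on stalks does (`mapSection_bracket_iff_stalkAct_lie`).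

The inverse of a bijective morphism of Lie algebroids is again a morphism
(`VectorBundleIso.IsLieAlgebroidHom.symm`). All sections that have to be extended live on the
Hausdorff manifold `X`, and not on `G`, which may fail to be Hausdorff.
-/

noncomputable section

namespace VectorBundleIso

variable {E : Type*} [NormedAddCommGroup E] [NormedSpace ℝ E]
  {X : Type*} [TopologicalSpace X] [ChartedSpace E X] [IsManifold 𝓘(ℝ, E) ∞ X]
  {F : Type*} [NormedAddCommGroup F] [NormedSpace ℝ F]
  {V : X → Type*} [TopologicalSpace (TotalSpace F V)] [∀ x, TopologicalSpace (V x)]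
  [∀ x, AddCommGroup (V x)] [∀ x, Module ℝ (V x)] [FiberBundle F V] [VectorBundle ℝ F V]
  {W : X → Type*} [TopologicalSpace (TotalSpace F W)] [∀ x, TopologicalSpace (W x)]
  [∀ x, AddCommGroup (W x)] [∀ x, Module ℝ (W x)] [FiberBundle F W] [VectorBundle ℝ F W]

theorem symm_mapSection_mapSection (ψ : VectorBundleIso E F V W) (ξ : Cₛ^∞⟮𝓘(ℝ, E); F, V⟯) :
    ψ.symm.mapSection (ψ.mapSection ξ) = ξ :=
  ContMDiffSection.ext fun x => (ψ.toEquiv x).symm_apply_apply (ξ x)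

theorem mapSection_symm_mapSection (ψ : VectorBundleIso E F V W) (ξ : Cₛ^∞⟮𝓘(ℝ, E); F, W⟯) :
    ψ.mapSection (ψ.symm.mapSection ξ) = ξ :=
  ContMDiffSection.ext fun x => (ψ.toEquiv x).apply_symm_apply (ξ x)

theorem IsLieAlgebroidHom.symm {ψ : VectorBundleIso E F V W} {L : LieAlgebroid E F V}
    {M : LieAlgebroid E F W} (h : ψ.IsLieAlgebroidHom L M) : ψ.symm.IsLieAlgebroidHom M L where
  anchor_comp x w := by
    rw [← h.anchor_comp]
    exact congrArg (M.anchor x) ((ψ.toEquiv x).apply_symm_apply w)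
  map_bracket ξ η := by
    conv_lhs => rw [← ψ.mapSection_symm_mapSection ξ, ← ψ.mapSection_symm_mapSection η]
    rw [← h.map_bracket, symm_mapSection_mapSection]

theorem isLieAlgebroidIso_iff_isLieAlgebroidHom {ψ : VectorBundleIso E F V W}
    {L : LieAlgebroid E F V} {M : LieAlgebroid E F W} :
    ψ.IsLieAlgebroidIso L M ↔ ψ.IsLieAlgebroidHom L M :=
  ⟨fun h => h.1, fun h => ⟨h, h.symm⟩⟩

end VectorBundleIso

namespace EtaleLieGroupoid

variable {E' E : Type*} [NormedAddCommGroup E'] [NormedSpace ℝ E']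
  [NormedAddCommGroup E] [NormedSpace ℝ E]
  {G X : Type*} [TopologicalSpace G] [ChartedSpace E' G] [IsManifold 𝓘(ℝ, E') ∞ G]
  [TopologicalSpace X] [ChartedSpace E X] [IsManifold 𝓘(ℝ, E) ∞ X]
  {F : Type*} [NormedAddCommGroup F] [NormedSpace ℝ F]
  {A : X → Type*} [TopologicalSpace (TotalSpace F A)] [∀ x, TopologicalSpace (A x)]
  [∀ x, AddCommGroup (A x)] [∀ x, Module ℝ (A x)] [FiberBundle F A] [VectorBundle ℝ F A]
  {𝒢 : EtaleLieGroupoid E' E G X}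

/-- The action of `g` on `TX` is `t_* ∘ (s_*|_g)⁻¹`, by the chain rule for `t = l_W ∘ s` near `g`. -/
theorem tangentAction_apply (g : G) (v : TangentSpace 𝓘(ℝ, E) (𝒢.source g)) :
    𝒢.tangentAction g v = mfderiv 𝓘(ℝ, E') 𝓘(ℝ, E) 𝒢.target g
      ((𝒢.source_etale.mfderivToContinuousLinearEquiv (by simp) g).symm v) := by
  set θ := (𝒢.source_etale g).localInverse with hθ
  have hs : 𝒢.source g ∈ θ.source := (𝒢.source_etale g).localInverse_mem_source
  have ht : g ∈ θ.target := (𝒢.source_etale g).localInverse_mem_target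
  have hg : θ (𝒢.source g) = g := (𝒢.source_etale g).localInverse_left_inv ht
  have hθd : MDifferentiableAt 𝓘(ℝ, E) 𝓘(ℝ, E') θ (𝒢.source g) :=
    θ.mdifferentiableAt (by simp) hs
  have hd : MDifferentiableAt 𝓘(ℝ, E) 𝓘(ℝ, E) (𝒢.germDiffeo g) (𝒢.source g) :=
    MDifferentiableAt.comp _ (𝒢.target.contMDiff.mdifferentiable (by simp) _) hθd
  have hsd : MDifferentiableAt 𝓘(ℝ, E') 𝓘(ℝ, E) 𝒢.source g :=
    𝒢.source.contMDiff.mdifferentiable (by simp) g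
  have hc := mfderiv_comp g hd hsd
  have he : mfderiv 𝓘(ℝ, E') 𝓘(ℝ, E) (𝒢.germDiffeo g ∘ 𝒢.source) g =
      mfderiv 𝓘(ℝ, E') 𝓘(ℝ, E) 𝒢.target g :=
    Filter.EventuallyEq.mfderiv_eq (by
      filter_upwards [θ.open_target.mem_nhds ht] with z hz
      exact congrArg 𝒢.target ((𝒢.source_etale g).localInverse_left_inv hz))
  set T := 𝒢.source_etale.mfderivToContinuousLinearEquiv (by simp) g
  have hT : mfderiv 𝓘(ℝ, E') 𝓘(ℝ, E) 𝒢.source g (T.symm v) = v := T.apply_symm_apply v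
  have e := congrArg (fun S : E' →L[ℝ] E => S (T.symm v)) (hc.symm.trans he)
  refine Eq.trans ?_ e
  exact congrArg (𝒢.tangentAction g) hT.symm

variable [FiniteDimensional ℝ E] [T2Space X]
  (L : LieAlgebroid E F A)
  (ψ : VectorBundleIso E' F ((𝒢.source : G → X) *ᵖ A) ((𝒢.target : G → X) *ᵖ A))

theorem etalePullback_anchor_comp_iff_isEquivariantAnchor [FiniteDimensional ℝ E'] :
    (∀ g (a : ((𝒢.source : G → X) *ᵖ A) g),
      (L.etalePullback 𝒢.target_etale).anchor g (ψ.toEquiv g a) =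
        (L.etalePullback 𝒢.source_etale).anchor g a) ↔ IsEquivariantAnchor ψ L := by
  refine forall_congr' fun g => forall_congr' fun a => ?_
  rw [tangentAction_apply]
  exact ContinuousLinearEquiv.symm_apply_eq
    (𝒢.target_etale.mfderivToContinuousLinearEquiv (by simp) g)

variable {ψ}

/-- If `σ = s^*ξ` and `ψ ∘ σ = t^*ξ'` near `g`, then `g` maps the germ of `ξ` to that of `ξ'`. -/
theorem stalkAct_germ_eq_of_rep {g : G}
    {σ : Cₛ^∞⟮𝓘(ℝ, E'); F, ((𝒢.source : G → X) *ᵖ A)⟯} {ξ ξ' : Cₛ^∞⟮𝓘(ℝ, E); F, A⟯}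
    (hξ : ∀ᶠ z in 𝓝 g, σ z = ξ (𝒢.source z))
    (hξ' : ∀ᶠ z in 𝓝 g, ψ.mapSection σ z = ξ' (𝒢.target z)) :
    stalkAct ψ L g (L.germ _ ξ) = L.germ _ ξ' := by
  rw [stalkAct_germ_eq_iff]
  filter_upwards [hξ, hξ'] with z h h'
  rw [← h', ← h]
  rfl

variable (ψ)

theorem mapSection_bracket_iff_stalkAct_lie [FiniteDimensional ℝ E'] :
    (∀ σ τ, ψ.mapSection ((L.etalePullback 𝒢.source_etale).bracket σ τ) =
      (L.etalePullback 𝒢.target_etale).bracket (ψ.mapSection σ) (ψ.mapSection τ)) ↔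
    ∀ (g : G) (a b : L.Stalk (𝒢.source g)),
      stalkAct ψ L g ⁅a, b⁆ = ⁅stalkAct ψ L g a, stalkAct ψ L g b⁆ := by
  constructor
  · intro h g a b
    obtain ⟨ξ, rfl⟩ := L.germ_surjective _ a
    obtain ⟨η, rfl⟩ := L.germ_surjective _ b
    -- Pullbacks of global sections are global, so `h` applies to them without any extension over
    -- the possibly non-Hausdorff `G`.
    set σ := pullbackSection 𝒢.source ξ
    set τ := pullbackSection 𝒢.source η
    obtain ⟨ξ', hξ'⟩ := LieAlgebroid.exists_rep 𝒢.target_etale (ψ.mapSection σ) g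
    obtain ⟨η', hη'⟩ := LieAlgebroid.exists_rep 𝒢.target_etale (ψ.mapSection τ) g
    have hσ : ∀ᶠ z in 𝓝 g, σ z = ξ (𝒢.source z) := Eventually.of_forall fun _ => rfl
    have hτ : ∀ᶠ z in 𝓝 g, τ z = η (𝒢.source z) := Eventually.of_forall fun _ => rfl
    rw [stalkAct_germ_eq_of_rep L hσ hξ', stalkAct_germ_eq_of_rep L hτ hη', L.germ_bracket,
      L.germ_bracket]
    refine stalkAct_germ_eq_of_rep L
      (LieAlgebroid.etaleBracket_eventuallyEq 𝒢.source_etale σ τ hσ hτ) ?_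
    filter_upwards [LieAlgebroid.etaleBracket_eventuallyEq (L := L) 𝒢.target_etale _ _ hξ' hη']
      with z hz
    exact (congrArg (fun ζ : Cₛ^∞⟮𝓘(ℝ, E'); F, ((𝒢.target : G → X) *ᵖ A)⟯ => ζ z) (h σ τ)).trans hz
  · intro h σ τ
    ext g
    obtain ⟨ξ, hξ⟩ := LieAlgebroid.exists_rep 𝒢.source_etale σ g
    obtain ⟨η, hη⟩ := LieAlgebroid.exists_rep 𝒢.source_etale τ g
    obtain ⟨ξ', hξ'⟩ := LieAlgebroid.exists_rep 𝒢.target_etale (ψ.mapSection σ) g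
    obtain ⟨η', hη'⟩ := LieAlgebroid.exists_rep 𝒢.target_etale (ψ.mapSection τ) g
    have e := h g (L.germ _ ξ) (L.germ _ η)
    rw [stalkAct_germ_eq_of_rep L hξ hξ', stalkAct_germ_eq_of_rep L hη hη', L.germ_bracket,
      L.germ_bracket, stalkAct_germ_eq_iff] at e
    exact (congrArg (ψ.toEquiv g)
      (LieAlgebroid.etaleBracket_apply 𝒢.source_etale σ τ hξ hη)).trans
        (e.self_of_nhds.trans
          (LieAlgebroid.etaleBracket_apply 𝒢.target_etale _ _ hξ' hη').symm)

theorem isSheafOfLieAlgebras_iff_stalkAct_lie :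
    IsSheafOfLieAlgebras ψ L ↔ ∀ (g : G) (a b : L.Stalk (𝒢.source g)),
      stalkAct ψ L g ⁅a, b⁆ = ⁅stalkAct ψ L g a, stalkAct ψ L g b⁆ := by
  refine forall_congr' fun g => ⟨?_, fun h => ?_⟩
  · rintro ⟨e, he⟩ a b
    rw [← he, ← he, ← he, LieEquiv.map_lie]
  · exact ⟨{ stalkAct ψ L g with map_lie' := h _ _ }, fun _ => rfl⟩

end EtaleLieGroupoid

end

theorem mainTheorem9 {E' E : Type*} [NormedAddCommGroup E'] [NormedSpace ℝ E']
    [FiniteDimensional ℝ E'] [NormedAddCommGroup E] [NormedSpace ℝ E] [FiniteDimensional ℝ E]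
    {G X : Type*} [TopologicalSpace G] [ChartedSpace E' G] [IsManifold 𝓘(ℝ, E') ∞ G]
    [TopologicalSpace X] [T2Space X] [ChartedSpace E X] [IsManifold 𝓘(ℝ, E) ∞ X]
    {F : Type*} [NormedAddCommGroup F] [NormedSpace ℝ F] [FiniteDimensional ℝ F]
    {A : X → Type*} [TopologicalSpace (TotalSpace F A)] [∀ x, TopologicalSpace (A x)]
    [∀ x, AddCommGroup (A x)] [∀ x, Module ℝ (A x)] [FiberBundle F A] [VectorBundle ℝ F A]
    [ContMDiffVectorBundle ∞ F A 𝓘(ℝ, E)]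
    (𝒢 : EtaleLieGroupoid E' E G X) (L : LieAlgebroid E F A)
    (ψ : VectorBundleIso E' F ((𝒢.source : G → X) *ᵖ A) ((𝒢.target : G → X) *ᵖ A))
    (hψ : EtaleLieGroupoid.IsCocycle ψ) :
    ψ.IsLieAlgebroidIso (L.etalePullback 𝒢.source_etale) (L.etalePullback 𝒢.target_etale) ↔
      EtaleLieGroupoid.IsEquivariantAnchor ψ L ∧ EtaleLieGroupoid.IsSheafOfLieAlgebras ψ L := by
  rw [VectorBundleIso.isLieAlgebroidIso_iff_isLieAlgebroidHom,
    ← EtaleLieGroupoid.etalePullback_anchor_comp_iff_isEquivariantAnchor,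
    EtaleLieGroupoid.isSheafOfLieAlgebras_iff_stalkAct_lie,
    ← EtaleLieGroupoid.mapSection_bracket_iff_stalkAct_lie]
  exact ⟨fun h => ⟨h.anchor_comp, h.map_bracket⟩, fun h => ⟨h.1, h.2⟩⟩
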